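/- Let $S$ be a scheme, $X$ an $S$-scheme and $G$ a group scheme over $S$. For $n\ge 0$ let $\Delta^n_{X/S}$ be the infinitesimal neighbourhood of the diagonal $X\subset X^{n+1}$ (fibre power over $S$) defined by the ideal generated by all products $d^{r,s}a\,d^{r,s}b$ $(0\le r<s\le n)$ and $d^{0,r}b\,d^{0,s}b$ $(1\le r,s\le n)$, where $a,b$ are local functions on $X$ and $d^{r,s}b=\mathrm{pr}_s^*b-\mathrm{pr}_r^*b$. Thus, for an $S$-scheme $T$, a $T$-valued point of $\Delta^n_{X/S}$ is a family $(x_0,\dots,x_n)$ of $S$-morphisms $T\to X$ that coincide on underlying spaces, are pairwise congruent modulo ideals of square zero, and satisfy $(b(x_i)-b(x_0))(b(x_j)-b(x_0))=0$ for all $i,j$ and all local functions $b$ on $X$. For a group-valued functor $F$ on $S$-schemes, an $F$-valued combinatorial $n$-form is a morphism $\Delta^n_{X/S}\to F$ that is trivial on each partial diagonal $x_i=x_{i+1}$; these forms make up $\Psi^n_{X/S}(F)$. Let $\underline{\mathrm{Aut}}(G)$ be the functor $T\mapsto \mathrm{Aut}_{T\text{-gp}}(G_T)$, and let $i:G\to\underline{\mathrm{Aut}}(G)$,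 $i_\gamma(g)=\gamma g\gamma^{-1}$, be inner conjugation. Let $\chi:\Delta^1_{X/S}\to\underline{\mathrm{Aut}}(G)$ be an $\underline{\mathrm{Aut}}(G)$-valued combinatorial 1-form and $\eta:\Delta^2_{X/S}\to G$ a $G$-valued combinatorial 2-form, and put $$(\delta^1\chi)(x,y,z)=\chi(x,y)\,\chi(y,z)\,\chi(z,x),$$ $$(\delta^2_\chi\eta)(x,y,z,u)=\chi(x,y)(\eta(y,z,u))\;\eta(x,y,u)\,\eta(x,u,z)\,\eta(x,z,y),$$ and, for a $G$-valued 3-form $\Omega$, $$(\delta^3_\chi\Omega)(x,y,z,u,v)=\chi(x,y)(\Omega(y,z,u,v))\;\Omega(x,y,u,v)\,\Omega(x,y,z,u)\,\Omega(x,z,u,v)^{-1}\,\Omega(x,y,z,v)^{-1}.$$ Suppose that $\delta^1\chi=i_*\eta$, where $i_*\eta=i\circ\eta$. Then $\delta^2_\chi\eta$ is a $G$-valued combinatorial 3-form, and $$\delta^3_\chi(\delta^2_\chi(\eta))=1,$$ the unit element (written $0$ in additive notation) of $\Psi^4_{X/S}(G)$. -/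

import Mathlib

open CategoryTheory AlgebraicGeometry Opposite

universe u v w

namespace CombForm

/-! ### Infinitesimal simplices

For an `S`-scheme `X`, the scheme `Δⁿ_{X/S}` is the neighbourhood of the diagonal in the
`(n+1)`-fold fibre power of `X` over `S` cut out by the ideal generated by

* the products `dʳˢa · dʳˢb` (that is, the sum of the squares `J_{rs}²` of the ideals of the
  partial diagonals), and
* the products `d⁰ʳb · d⁰ˢb`,

where `dʳˢb = pr_s^* b - pr_r^* b` for local functions `a`, `b` on `X`. It is used here, as every
`S`-scheme, through its functor of points. -/

/-- The morphisms `x 0, …, x n : T ⟶ X` form a `T`-valued point of the scheme of infinitesimal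
`n`-simplices: they agree on the underlying spaces, any two of them are congruent modulo an ideal
of square zero, and `(b(x_i) - b(x_0)) (b(x_j) - b(x_0)) = 0` for every local function `b`.
(`(x i).appLE U V _ b` is the function `b(x_i)`, restricted to `V`.) -/
structure IsInfSimplex {T X : Scheme.{u}} {n : ℕ} (x : Fin (n + 1) → (T ⟶ X)) : Prop where
  base_eq : ∀ i j, (x i).base = (x j).base
  sq_zero : ∀ (i j : Fin (n + 1)) (U : X.Opens) (V : T.Opens)
    (hi : V ≤ x i ⁻¹ᵁ U) (hj : V ≤ x j ⁻¹ᵁ U) (a b : Γ(X, U)),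
    ((x j).appLE U V hj a - (x i).appLE U V hi a) *
      ((x j).appLE U V hj b - (x i).appLE U V hi b) = 0
  strong : ∀ (i j : Fin (n + 1)) (U : X.Opens) (V : T.Opens)
    (h0 : V ≤ x 0 ⁻¹ᵁ U) (hi : V ≤ x i ⁻¹ᵁ U) (hj : V ≤ x j ⁻¹ᵁ U) (b : Γ(X, U)),
    ((x i).appLE U V hi b - (x 0).appLE U V h0 b) *
      ((x j).appLE U V hj b - (x 0).appLE U V h0 b) = 0

theorem IsInfSimplex.le_preimage {T X : Scheme.{u}} {n : ℕ} {x : Fin (n + 1) → (T ⟶ X)}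
    (hx : IsInfSimplex x) (i j : Fin (n + 1)) {U : X.Opens} {V : T.Opens}
    (h : V ≤ x i ⁻¹ᵁ U) : V ≤ x j ⁻¹ᵁ U := by
  have e := hx.base_eq i j
  intro t ht
  have := h ht
  change (x j).base t ∈ U
  rw [← e]
  exact this

theorem appLE_comp_apply {T' T X : Scheme.{u}} (f : T' ⟶ T) (g : T ⟶ X) (U : X.Opens)
    (W : T.Opens) (V : T'.Opens) (e₁ : W ≤ g ⁻¹ᵁ U) (e₂ : V ≤ f ⁻¹ᵁ W)
    (e : V ≤ (f ≫ g) ⁻¹ᵁ U) (a : Γ(X, U)) :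
    (f ≫ g).appLE U V e a = f.appLE W V e₂ (g.appLE U W e₁ a) := by
  rw [← CategoryTheory.comp_apply, Scheme.Hom.appLE_comp_appLE]

theorem IsInfSimplex.precomp {T' T X : Scheme.{u}} {n : ℕ} {x : Fin (n + 1) → (T ⟶ X)}
    (hx : IsInfSimplex x) (f : T' ⟶ T) : IsInfSimplex fun i => f ≫ x i where
  base_eq i j := by simp only [Scheme.Hom.comp_base, hx.base_eq i j]
  sq_zero i j U V hi hj a b := by
    have hW : x i ⁻¹ᵁ U ≤ x j ⁻¹ᵁ U := hx.le_preimage i j le_rfl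
    have hV : V ≤ f ⁻¹ᵁ (x i ⁻¹ᵁ U) := hi
    simp only [appLE_comp_apply f (x j) U (x i ⁻¹ᵁ U) V hW hV,
      appLE_comp_apply f (x i) U (x i ⁻¹ᵁ U) V le_rfl hV, ← map_sub, ← map_mul]
    rw [hx.sq_zero i j U _ le_rfl hW, map_zero]
  strong i j U V h0 hi hj b := by
    have hWi : x 0 ⁻¹ᵁ U ≤ x i ⁻¹ᵁ U := hx.le_preimage 0 i le_rfl
    have hWj : x 0 ⁻¹ᵁ U ≤ x j ⁻¹ᵁ U := hx.le_preimage 0 j le_rfl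
    have hV : V ≤ f ⁻¹ᵁ (x 0 ⁻¹ᵁ U) := h0
    simp only [appLE_comp_apply f (x j) U (x 0 ⁻¹ᵁ U) V hWj hV,
      appLE_comp_apply f (x i) U (x 0 ⁻¹ᵁ U) V hWi hV,
      appLE_comp_apply f (x 0) U (x 0 ⁻¹ᵁ U) V le_rfl hV, ← map_sub, ← map_mul]
    rw [hx.strong i j U _ le_rfl hWi hWj, map_zero]

theorem IsInfSimplex.reindex {T X : Scheme.{u}} {m n : ℕ} {x : Fin (n + 1) → (T ⟶ X)}
    (hx : IsInfSimplex x) (α : Fin (m + 1) → Fin (n + 1)) :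
    IsInfSimplex fun i => x (α i) where
  base_eq i j := hx.base_eq (α i) (α j)
  sq_zero i j := hx.sq_zero (α i) (α j)
  strong i j U V h0 hi hj b := by
    have hz : V ≤ x 0 ⁻¹ᵁ U := hx.le_preimage _ 0 h0
    have h1 := hx.strong (α i) (α j) U V hz hi hj b
    have h2 := hx.strong (α i) (α 0) U V hz hi h0 b
    have h3 := hx.strong (α 0) (α j) U V hz h0 hj b
    have h4 := hx.strong (α 0) (α 0) U V hz h0 h0 b
    linear_combination h1 - h2 - h3 + h4

variable {S : Scheme.{u}}

/-- The set `Δⁿ_{X/S}(T)` of `T`-valued points `(x_0, …, x_n)` of `Δⁿ_{X/S}`. -/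
structure Simplex (X : Over S) (n : ℕ) (T : Over S) where
  vertex : Fin (n + 1) → (T ⟶ X)
  isInf : IsInfSimplex fun i => (vertex i).left

/-- The restriction map `Δⁿ_{X/S}(T) → Δⁿ_{X/S}(T')` along an `S`-morphism `f : T' ⟶ T`. -/
def Simplex.precomp {X : Over S} {n : ℕ} {T T' : Over S} (x : Simplex X n T) (f : T' ⟶ T) :
    Simplex X n T' where
  vertex i := f ≫ x.vertex i
  isInf := by simpa only [Over.comp_left] using x.isInf.precomp f.left

/-- The projection `Δⁿ_{X/S} → Δᵐ_{X/S}`, `(x_0, …, x_n) ↦ (x_{α 0}, …, x_{α m})`. -/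
def Simplex.proj {X : Over S} {m n : ℕ} {T : Over S} (x : Simplex X n T)
    (α : Fin (m + 1) → Fin (n + 1)) : Simplex X m T where
  vertex i := x.vertex (α i)
  isInf := x.isInf.reindex α

theorem Simplex.precomp_proj {X : Over S} {m n : ℕ} {T T' : Over S} (x : Simplex X n T)
    (f : T' ⟶ T) (α : Fin (m + 1) → Fin (n + 1)) :
    (x.precomp f).proj α = (x.proj α).precomp f := rfl

/-! ### The sheaf of automorphisms of a group-valued functor -/

section AutPresheaf

variable {C : Type v} [Category.{u} C]

/-- A `T`-valued section of `Aut(F)`: an automorphism of the restriction `F_T` of the group-valued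
functor `F` to the category of objects over `T`, i.e. a family of group automorphisms of `F(U)`
for all `t : U ⟶ T`, compatible with restriction. When `F` is represented by a group scheme `G`,
this is the same as an automorphism of the `T`-group scheme `G ×_S T`. -/
@[ext]
structure AutSection (F : Cᵒᵖ ⥤ GrpCat.{w}) (T : C) where
  act : ∀ ⦃U : C⦄, (U ⟶ T) → MulAut (F.obj (op U))
  natural : ∀ ⦃U U' : C⦄ (t : U ⟶ T) (s : U' ⟶ U) (g : F.obj (op U)),
    F.map s.op (act t g) = act (s ≫ t) (F.map s.op g)

namespace AutSection

variable {F : Cᵒᵖ ⥤ GrpCat.{w}} {T : C}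

instance : One (AutSection F T) := ⟨⟨fun _ _ => 1, fun _ _ _ _ _ => rfl⟩⟩

instance : Mul (AutSection F T) :=
  ⟨fun a b => ⟨fun _ t => a.act t * b.act t, fun U U' t s g => by
    simp only [MulAut.mul_apply, a.natural, b.natural]⟩⟩

instance : Inv (AutSection F T) :=
  ⟨fun a => ⟨fun _ t => (a.act t)⁻¹, fun U U' t s g => by
    apply (a.act (s ≫ t)).injective
    rw [← a.natural, MulAut.apply_inv_self, MulAut.apply_inv_self]⟩⟩

/-- Multiplication is composition of automorphisms. -/
instance : Group (AutSection F T) :=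
  Group.ofLeftAxioms
    (fun _ _ _ => AutSection.ext (by funext U t; exact mul_assoc _ _ _))
    (fun _ => AutSection.ext (by funext U t; exact one_mul _))
    (fun _ => AutSection.ext (by funext U t; exact inv_mul_cancel _))

/-- Restriction of a section of `Aut(F)` along `f : T' ⟶ T`. -/
def restrict {T' : C} (f : T' ⟶ T) : AutSection F T →* AutSection F T' where
  toFun a := ⟨fun _ t => a.act (t ≫ f), fun U U' t s g => by
    rw [a.natural, Category.assoc]⟩
  map_one' := rfl
  map_mul' _ _ := rfl

/-- The canonical pairing `Aut(F) × F → F`, `(u, g) ↦ u(g)`, on `T`-valued sections. -/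
def apply (a : AutSection F T) (g : F.obj (op T)) : F.obj (op T) := a.act (𝟙 T) g

theorem map_apply (a : AutSection F T) (g : F.obj (op T)) {T' : C} (f : T' ⟶ T) :
    F.map f.op (a.apply g) = (restrict f a).apply (F.map f.op g) := by
  change F.map f.op (a.act _ g) = a.act _ _
  rw [a.natural]
  simp

/-- Inner conjugation `i : F → Aut(F)`, `i_γ(g) = γ g γ⁻¹`, on `T`-valued sections. -/
def conj (γ : F.obj (op T)) : AutSection F T where
  act _ t := MulAut.conj (F.map t.op γ)
  natural U U' t s g := by simp [MulAut.conj_apply]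

theorem restrict_conj (γ : F.obj (op T)) {T' : C} (f : T' ⟶ T) :
    restrict f (conj γ) = conj (F.map f.op γ) := by
  ext U t g
  simp [restrict, conj]

end AutSection

/-- The functor `Aut(F) : T ↦ Aut(F_T)`. -/
abbrev autPresheaf (F : Cᵒᵖ ⥤ GrpCat.{w}) : Cᵒᵖ ⥤ GrpCat.{max u v w} where
  obj T := GrpCat.of (AutSection F T.unop)
  map f := GrpCat.ofHom (AutSection.restrict f.unop)
  map_id T := by
    refine GrpCat.hom_ext (MonoidHom.ext fun a => AutSection.ext ?_)
    funext U t
    change a.act (t ≫ 𝟙 _) = a.act t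
    rw [Category.comp_id]
  map_comp f g := by
    refine GrpCat.hom_ext (MonoidHom.ext fun a => AutSection.ext ?_)
    funext U t
    change a.act (t ≫ g.unop ≫ f.unop) = a.act ((t ≫ g.unop) ≫ f.unop)
    rw [Category.assoc]

end AutPresheaf

/-! ### Combinatorial forms -/

/-- A morphism of functors `φ : Δⁿ_{X/S} → F`: a rule `(x_0, …, x_n) ↦ φ(x_0, …, x_n) ∈ F(T)` for
`T`-valued points of `Δⁿ_{X/S}`, functorial in the `S`-scheme `T`. -/
@[ext]
structure Cochain (X : Over S) (n : ℕ) (F : (Over S)ᵒᵖ ⥤ GrpCat.{w}) where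
  eval : ∀ ⦃T : Over S⦄, Simplex X n T → F.obj (op T)
  natural : ∀ ⦃T T' : Over S⦄ (f : T' ⟶ T) (x : Simplex X n T),
    F.map f.op (eval x) = eval (x.precomp f)

variable {X : Over S} {n : ℕ} {F : (Over S)ᵒᵖ ⥤ GrpCat.{w}}

/-- `φ : Δⁿ_{X/S} → F` is an `F`-valued combinatorial `n`-form, i.e. `φ ∈ Ψⁿ_{X/S}(F)`: its
restriction to each of the partial diagonals `x_i = x_{i+1}` is trivial. -/
def Cochain.IsForm (φ : Cochain X n F) : Prop :=
  ∀ ⦃T : Over S⦄ (x : Simplex X n T) (i : Fin n),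
    x.vertex i.castSucc = x.vertex i.succ → φ.eval x = 1

/-- The trivial morphism `Δⁿ_{X/S} → F`, the unit of `Ψⁿ_{X/S}(F)`. -/
instance : One (Cochain X n F) := ⟨⟨fun _ _ => 1, fun _ _ _ _ => map_one _⟩⟩

/-- `(δ¹ω)(x, y, z) = ω(x, y) ω(y, z) ω(z, x)`. -/
def delta1 (ω : Cochain X 1 F) : Cochain X 2 F where
  eval _ x := ω.eval (x.proj ![0, 1]) * ω.eval (x.proj ![1, 2]) * ω.eval (x.proj ![2, 0])
  natural T T' f x := by simp only [map_mul, ω.natural, Simplex.precomp_proj]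

/-- The `Aut(F)`-valued `i_*η`, where `i : F → Aut(F)` is inner conjugation. -/
def innerPush (η : Cochain X n F) : Cochain X n (autPresheaf F) where
  eval _ x := AutSection.conj (η.eval x)
  natural T T' f x := by
    change AutSection.restrict f (AutSection.conj (η.eval x)) = _
    rw [AutSection.restrict_conj, η.natural]

/-- `χ(x, y)(g)` for an infinitesimal 1-simplex `(x, y)` over `T` and `g ∈ F(T)`. -/
def act (χ : Cochain X 1 (autPresheaf F)) {T : Over S} (x : Simplex X 1 T)
    (g : F.obj (op T)) : F.obj (op T) :=
  AutSection.apply (χ.eval x) g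

theorem map_act (χ : Cochain X 1 (autPresheaf F)) {T T' : Over S} (f : T' ⟶ T)
    (x : Simplex X 1 T) (g : F.obj (op T)) :
    F.map f.op (act χ x g) = act χ (x.precomp f) (F.map f.op g) := by
  exact (AutSection.map_apply (χ.eval x) g f).trans
    (congrArg (fun a => AutSection.apply a (F.map f.op g)) (χ.natural f x))

/-- `(δ²_χ φ)(x, y, z, u) = χ(x, y)(φ(y, z, u)) φ(x, y, u) φ(x, u, z) φ(x, z, y)`. -/
def delta2 (χ : Cochain X 1 (autPresheaf F)) (φ : Cochain X 2 F) : Cochain X 3 F where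
  eval _ x :=
    act χ (x.proj ![0, 1]) (φ.eval (x.proj ![1, 2, 3])) * φ.eval (x.proj ![0, 1, 3]) *
      φ.eval (x.proj ![0, 3, 2]) * φ.eval (x.proj ![0, 2, 1])
  natural T T' f x := by simp only [map_mul, map_act, φ.natural, Simplex.precomp_proj]

/-- `(δ³_χ Ω)(x, y, z, u, v) =
χ(x, y)(Ω(y, z, u, v)) Ω(x, y, u, v) Ω(x, y, z, u) Ω(x, z, u, v)⁻¹ Ω(x, y, z, v)⁻¹`. -/
def delta3 (χ : Cochain X 1 (autPresheaf F)) (Ω : Cochain X 3 F) : Cochain X 4 F where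
  eval _ x :=
    act χ (x.proj ![0, 1]) (Ω.eval (x.proj ![1, 2, 3, 4])) * Ω.eval (x.proj ![0, 1, 3, 4]) *
      Ω.eval (x.proj ![0, 1, 2, 3]) * (Ω.eval (x.proj ![0, 2, 3, 4]))⁻¹ *
        (Ω.eval (x.proj ![0, 1, 2, 4]))⁻¹
  natural T T' f x := by
    simp only [map_mul, map_inv, map_act, Ω.natural, Simplex.precomp_proj]

end CombForm

/-! Write a_ij = χ(x_i, x_j) and h_ijk = η(x_i, x_j, x_k). Suppose η(x, y, z) η(x, z, y) = 1. Then
δ¹χ = i_*η, read also on degenerate triples, says a_ij a_jk = conj(h_ijk) a_ik, and δ²_χ η becomes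
a_ij(h_jkl) h_ijl h_ikl⁻¹ h_ijk⁻¹. This is the Eilenberg–MacLane obstruction: it is central
(`obstruction_central`), and evaluating one word in two ways yields the cocycle identity
(`obstruction_cocycle`).

The geometric input is the alternation of η, `Cochain.IsForm.isAlternating`. Locally every simplex
is pulled back from a universal one over an affine open. Since η is trivial on the diagonal and Δⁿ
is a nilpotent thickening of it, the values of η lie in an affine neighbourhood of the unit section
and can be compared through coordinate functions f. For g = η(x, y, z) and g' = η(x, z, y), the
quantity f - f(1) is additive on the product g g' (`SimplexRing.reindex_eq_zero`) and changes sign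
from g to g' (`SimplexRing.add_swap_eq_zero`). Both facts hold because the ideal of the diagonal y =
z has square zero. Hence f(g g') = f(1). -/

namespace CombForm

/-! ### The nonabelian cocycle identity in an abstract group. -/

section GroupTheory

variable {H : Type*} [Group H]

/-- The obstruction to `h` being a cocycle twisted by `a`. -/
def obstruction {ι : Type*} (a : ι → ι → MulAut H) (h : ι → ι → ι → H) (i j k l : ι) : H :=
  a i j (h j k l) * h i j l * (h i k l)⁻¹ * (h i j k)⁻¹

variable {ι : Type*} {a : ι → ι → MulAut H} {h : ι → ι → ι → H}

theorem obstruction_mul (i j k l : ι) :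
    obstruction a h i j k l * (h i j k * h i k l) = a i j (h j k l) * h i j l := by
  simp only [obstruction]
  group

/-- Let P = h_ijk h_ikl. The two bracketings of a_ij a_jk a_kl give conj(P) a_il and
conj(obstruction · P) a_il, so conjugation by the obstruction is trivial. -/
theorem obstruction_central (hah : ∀ i j k, a i j * a j k = MulAut.conj (h i j k) * a i k)
    (i j k l : ι) (g : H) : obstruction a h i j k l * g = g * obstruction a h i j k l := by
  have e : ∀ i j k g, a i j (a j k g) = h i j k * a i k g * (h i j k)⁻¹ := fun i j k g => by
    simpa using DFunLike.congr_fun (hah i j k) g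
  -- Every element has the form P a_il(g) P⁻¹, so it suffices to test commutation on these.
  obtain ⟨g, rfl⟩ := (MulAut.conj (h i j k * h i k l) * a i l).surjective g
  have e₁ : a i j (a j k (a k l g)) =
      (h i j k * h i k l) * a i l g * (h i j k * h i k l)⁻¹ := by
    rw [e i j k, e i k l]
    group
  have e₂ : a i j (a j k (a k l g)) =
      (obstruction a h i j k l * (h i j k * h i k l)) * a i l g *
        (obstruction a h i j k l * (h i j k * h i k l))⁻¹ := by
    rw [e j k l, map_mul, map_mul, map_inv, e i j l, obstruction_mul]
    group
  rw [e₁] at e₂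
  simp only [MulAut.mul_apply, MulAut.conj_apply]
  nth_rewrite 2 [e₂]
  group

/-- The Eilenberg–MacLane cocycle identity. -/
theorem obstruction_cocycle (hah : ∀ i j k, a i j * a j k = MulAut.conj (h i j k) * a i k)
    (x y z u v : ι) :
    a x y (obstruction a h y z u v) * obstruction a h x y u v * obstruction a h x y z u *
      (obstruction a h x z u v)⁻¹ * (obstruction a h x y z v)⁻¹ = 1 := by
  have hc := obstruction_central hah
  have e : a x y (a y z (h z u v)) = h x y z * a x z (h z u v) * (h x y z)⁻¹ := by
    simpa using DFunLike.congr_fun (hah x y z) (h z u v)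
  -- The same word is reduced to h_xyz h_xzu h_xuv in two ways: here the obstruction of (y, z, u, v)
  -- is extracted inside a_xy; in `e₂`, a_xy a_yz is first replaced by conj(h_xyz) a_xz. Centrality
  -- collects the obstructions in front.
  have e₁ : a x y (a y z (h z u v) * h y z v) * h x y v =
      a x y (obstruction a h y z u v) * obstruction a h x y u v * obstruction a h x y z u *
        (h x y z * h x z u * h x u v) := by
    calc _ = a x y (obstruction a h y z u v) * a x y (h y z u) *
          (a x y (h y u v) * h x y v) := by
            rw [← obstruction_mul, map_mul, map_mul]; group
      _ = a x y (obstruction a h y z u v) * (a x y (h y z u) * obstruction a h x y u v) *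
          (h x y u * h x u v) := by rw [← obstruction_mul x y u v]; group
      _ = a x y (obstruction a h y z u v) * obstruction a h x y u v *
          (a x y (h y z u) * h x y u) * h x u v := by rw [← hc]; group
      _ = _ := by rw [← obstruction_mul]; group
  have e₂ : a x y (a y z (h z u v) * h y z v) * h x y v =
      obstruction a h x y z v * obstruction a h x z u v * (h x y z * h x z u * h x u v) := by
    calc _ = h x y z * a x z (h z u v) * (h x y z)⁻¹ * (a x y (h y z v) * h x y v) := by
            rw [map_mul, e]; group
      _ = h x y z * a x z (h z u v) * (h x y z)⁻¹ * (obstruction a h x y z v *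
            (h x y z * h x z v)) := by rw [← obstruction_mul x y z v]
      _ = obstruction a h x y z v * (h x y z * (a x z (h z u v) * h x z v)) := by
            rw [← mul_assoc _ (obstruction a h x y z v), ← hc]; group
      _ = obstruction a h x y z v * (h x y z * obstruction a h x z u v) *
            (h x z u * h x u v) := by rw [← obstruction_mul]; group
      _ = _ := by rw [← hc]; group
  rw [mul_inv_eq_one, mul_inv_eq_iff_eq_mul]
  exact mul_right_cancel (e₁.symm.trans e₂)

end GroupTheory

/-! ### Reduction of the statement about forms to the group identity, granted alternation. -/

theorem Simplex.ext_vertex {S : Scheme.{u}} {X : Over S} {n : ℕ} {T : Over S}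
    {x y : Simplex X n T} (h : ∀ i, x.vertex i = y.vertex i) : x = y := by
  cases x; cases y
  congr
  exact funext h

section Reduction

variable {S : Scheme.{u}} {X : Over S} {F : (Over S)ᵒᵖ ⥤ GrpCat.{w}}

/-- The value `η(x_i, x_j, x_k)` is inverse to `η(x_i, x_k, x_j)`. -/
def Cochain.IsAlternating (η : Cochain X 2 F) : Prop :=
  ∀ ⦃T : Over S⦄ (x : Simplex X 2 T), η.eval x * η.eval (x.proj ![0, 2, 1]) = 1

variable {χ : Cochain X 1 (autPresheaf F)} {η : Cochain X 2 F}

theorem Cochain.IsAlternating.eval_proj (hη : η.IsAlternating) {n : ℕ} {T : Over S}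
    (x : Simplex X n T) (i j k : Fin (n + 1)) :
    η.eval (x.proj ![i, j, k]) * η.eval (x.proj ![i, k, j]) = 1 := by
  convert hη (x.proj ![i, j, k]) using 3
  refine Simplex.ext_vertex fun l => ?_
  fin_cases l <;> rfl

theorem proj_proj_three {n m : ℕ} {T : Over S} (x : Simplex X n T)
    (β : Fin (m + 1) → Fin (n + 1)) (i j k : Fin (m + 1)) :
    (x.proj β).proj ![i, j, k] = x.proj ![β i, β j, β k] := by
  refine Simplex.ext_vertex fun l => ?_
  fin_cases l <;> rfl

theorem proj_proj_two {n m : ℕ} {T : Over S} (x : Simplex X n T)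
    (β : Fin (m + 1) → Fin (n + 1)) (i j : Fin (m + 1)) :
    (x.proj β).proj ![i, j] = x.proj ![β i, β j] := by
  refine Simplex.ext_vertex fun l => ?_
  fin_cases l <;> rfl

theorem act_eq_of_eval_eq_one {T : Over S} {x : Simplex X 1 T} (h : χ.eval x = 1)
    (g : F.obj (op T)) : act χ x g = g := by
  rw [act, h]
  rfl

theorem isForm_delta2 (hχ : χ.IsForm) (hη : η.IsForm) (hη' : η.IsAlternating) :
    (delta2 χ η).IsForm := by
  have act_one : ∀ {T : Over S} (x : Simplex X 1 T), act χ x 1 = 1 := fun x => map_one _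
  intro T x i hi
  change act χ (x.proj ![0, 1]) (η.eval (x.proj ![1, 2, 3])) * η.eval (x.proj ![0, 1, 3]) *
      η.eval (x.proj ![0, 3, 2]) * η.eval (x.proj ![0, 2, 1]) = 1
  fin_cases i
  · replace hi : x.vertex 0 = x.vertex 1 := hi
    rw [act_eq_of_eval_eq_one (hχ _ 0 hi), hη (x.proj ![0, 1, 3]) 0 hi, mul_one]
    have e₁ : x.proj ![1, 2, 3] = x.proj ![0, 2, 3] :=
      Simplex.ext_vertex fun l => by fin_cases l; exacts [hi.symm, rfl, rfl]
    have e₂ : x.proj ![0, 2, 1] = x.proj ![0, 2, 0] :=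
      Simplex.ext_vertex fun l => by fin_cases l; exacts [rfl, rfl, hi.symm]
    -- Triviality is known only for adjacent equal vertices; alternation carries it from (x_0, x_0,
    -- x_2) to (x_0, x_2, x_0).
    have e₃ := hη'.eval_proj x 0 2 0
    rw [hη (x.proj ![0, 0, 2]) 0 rfl, mul_one] at e₃
    rw [e₁, e₂, e₃, mul_one, hη'.eval_proj]
  · replace hi : x.vertex 1 = x.vertex 2 := hi
    have e₁ : x.proj ![0, 3, 2] = x.proj ![0, 3, 1] :=
      Simplex.ext_vertex fun l => by fin_cases l; exacts [rfl, rfl, hi.symm]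
    rw [hη (x.proj ![1, 2, 3]) 0 hi, act_one, hη (x.proj ![0, 2, 1]) 1 hi.symm, mul_one, one_mul,
      e₁, hη'.eval_proj]
  · replace hi : x.vertex 2 = x.vertex 3 := hi
    have e₁ : x.proj ![0, 1, 3] = x.proj ![0, 1, 2] :=
      Simplex.ext_vertex fun l => by fin_cases l; exacts [rfl, rfl, hi.symm]
    rw [hη (x.proj ![1, 2, 3]) 1 hi, act_one, hη (x.proj ![0, 3, 2]) 1 hi.symm, mul_one, one_mul,
      e₁, hη'.eval_proj]

theorem delta3_delta2 (hχ : χ.IsForm) (hη : η.IsForm) (hη' : η.IsAlternating)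
    (h : delta1 χ = innerPush η) : delta3 χ (delta2 χ η) = 1 := by
  refine Cochain.ext ?_
  funext T x
  let c (i j : Fin 5) : AutSection F T := χ.eval (x.proj ![i, j])
  let e (i j k : Fin 5) : F.obj (op T) := η.eval (x.proj ![i, j, k])
  let a (i j : Fin 5) : MulAut (F.obj (op T)) := (c i j).act (𝟙 T)
  have he (i j k) : e i j k * e i k j = 1 := hη'.eval_proj x i j k
  have hd (i j k) : c i j * c j k * c k i = AutSection.conj (e i j k) := by
    have := congrArg (fun φ => φ.eval (x.proj ![i, j, k])) h
    change χ.eval ((x.proj ![i, j, k]).proj ![0, 1]) * χ.eval ((x.proj ![i, j, k]).proj ![1, 2]) *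
      χ.eval ((x.proj ![i, j, k]).proj ![2, 0]) = AutSection.conj (e i j k) at this
    simp only [proj_proj_two] at this
    exact this
  have ha (i j k) : a i j * a j k * a k i = MulAut.conj (e i j k) := by
    have := congrArg (fun s : AutSection F T => s.act (𝟙 T)) (hd i j k)
    refine this.trans ?_
    change MulAut.conj (F.map (𝟙 T).op (e i j k)) = _
    simp
  have haa (i) : a i i = 1 := by
    have : c i i = 1 := hχ (x.proj ![i, i]) 0 rfl
    change (c i i).act (𝟙 T) = 1
    rw [this]
    rfl
  -- This is δ¹χ = i_*η on the triple (i, j, i), where η is trivial as the inverse of its value on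
  -- (i, i, j).
  have hinv (i j) : a i j * a j i = 1 := by
    have e₁ := he i j i
    rw [show e i i j = 1 from hη (x.proj ![i, i, j]) 0 rfl, mul_one] at e₁
    have := ha i j i
    rwa [haa, mul_one, e₁, map_one] at this
  have hah (i j k) : a i j * a j k = MulAut.conj (e i j k) * a i k := by
    rw [← ha, mul_assoc _ (a k i), hinv, mul_one]
  -- Alternation turns the last two factors of δ²_χ η into the inverses occurring in `obstruction`.
  have hob (i j k l) : (delta2 χ η).eval (x.proj ![i, j, k, l]) = obstruction a e i j k l := by
    rw [obstruction, inv_eq_of_mul_eq_one_right (he i k l), inv_eq_of_mul_eq_one_right (he i j k)]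
    change act χ ((x.proj ![i, j, k, l]).proj ![0, 1])
      (η.eval ((x.proj ![i, j, k, l]).proj ![1, 2, 3])) *
      η.eval ((x.proj ![i, j, k, l]).proj ![0, 1, 3]) *
      η.eval ((x.proj ![i, j, k, l]).proj ![0, 3, 2]) *
      η.eval ((x.proj ![i, j, k, l]).proj ![0, 2, 1]) = _
    simp only [proj_proj_two, proj_proj_three]
    rfl
  have := obstruction_cocycle hah 0 1 2 3 4
  simp only [← hob] at this
  exact this

end Reduction

/-! ### The coordinate ring of infinitesimal simplices of an affine scheme. -/

section SimplexRing

variable {K A : Type u} [CommRing K] [CommRing A]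

/-- Ring-theoretic infinitesimal simplices: families of ring homomorphisms `A → C` which agree on
`K` and satisfy the equations defining `Δⁿ`. -/
structure IsRingSimplex (φ : K →+* A) {C : Type u} [CommRing C] {n : ℕ}
    (x : Fin (n + 1) → A →+* C) : Prop where
  comp_eq : ∀ i j k, x i (φ k) = x j (φ k)
  sq_zero : ∀ i j a b, (x j a - x i a) * (x j b - x i b) = 0
  strong : ∀ i j b, (x i b - x 0 b) * (x j b - x 0 b) = 0

theorem IsRingSimplex.reindex {φ : K →+* A} {C : Type u} [CommRing C] {m n : ℕ}
    {x : Fin (n + 1) → A →+* C} (hx : IsRingSimplex φ x) (α : Fin (m + 1) → Fin (n + 1)) :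
    IsRingSimplex φ fun i => x (α i) where
  comp_eq i j := hx.comp_eq (α i) (α j)
  sq_zero i j := hx.sq_zero (α i) (α j)
  strong i j b := by
    linear_combination hx.strong (α i) (α j) b - hx.strong (α i) (α 0) b -
      hx.strong (α 0) (α j) b + hx.strong (α 0) (α 0) b

/-- The polynomials in the symbols `x_i(a)` that vanish on every ring simplex. -/
def relIdeal (φ : K →+* A) (n : ℕ) : Ideal (MvPolynomial (Fin (n + 1) × A) ℤ) where
  carrier := {p | ∀ (C : Type u) [CommRing C] (x : Fin (n + 1) → A →+* C),
    IsRingSimplex φ x → MvPolynomial.aeval (fun s : Fin (n + 1) × A => x s.1 s.2) p = 0}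
  add_mem' hp hq C _ x hx := by rw [map_add, hp C x hx, hq C x hx, add_zero]
  zero_mem' C _ x hx := map_zero _
  smul_mem' c p hp C _ x hx := by rw [smul_eq_mul, map_mul, hp C x hx, mul_zero]

/-- The coordinate ring of `Δⁿ` for an affine scheme over an affine base. -/
abbrev SimplexRing (φ : K →+* A) (n : ℕ) : Type u :=
  MvPolynomial (Fin (n + 1) × A) ℤ ⧸ relIdeal φ n

namespace SimplexRing

variable {φ : K →+* A} {C : Type u} [CommRing C] {m n : ℕ}

/-- The homomorphism classifying a ring simplex. -/
noncomputable def lift (x : Fin (n + 1) → A →+* C) (hx : IsRingSimplex φ x) : SimplexRing φ n →+* C :=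
  Ideal.Quotient.lift _
    (MvPolynomial.aeval (R := ℤ) fun s : Fin (n + 1) × A => x s.1 s.2).toRingHom
    fun _ hp => hp C x hx

theorem lift_mk_X (x : Fin (n + 1) → A →+* C) (hx : IsRingSimplex φ x) (i : Fin (n + 1))
    (a : A) : lift x hx (Ideal.Quotient.mk _ (MvPolynomial.X (i, a))) = x i a :=
  MvPolynomial.aeval_X (R := ℤ) (fun s : Fin (n + 1) × A => x s.1 s.2) (i, a)

/-- The ideal of relations is defined by vanishing on all simplices, not by generators, so an
equation may be tested on each simplex; the universal vertices get their ring and simplex axioms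
this way. -/
theorem eq_of_forall_lift {r s : SimplexRing φ n}
    (h : ∀ (C : Type u) [CommRing C] (x : Fin (n + 1) → A →+* C) (hx : IsRingSimplex φ x),
      lift x hx r = lift x hx s) : r = s := by
  obtain ⟨p, rfl⟩ := Ideal.Quotient.mk_surjective r
  obtain ⟨q, rfl⟩ := Ideal.Quotient.mk_surjective s
  refine Ideal.Quotient.eq.mpr fun C _ x hx => ?_
  rw [map_sub]
  exact sub_eq_zero.mpr (h C x hx)

variable (φ) in
/-- The `i`-th vertex of the universal simplex. -/
noncomputable def vertex (i : Fin (n + 1)) : A →+* SimplexRing φ n where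
  toFun a := Ideal.Quotient.mk _ (MvPolynomial.X (i, a))
  map_one' := eq_of_forall_lift fun C _ x hx => by simp only [lift_mk_X, map_one]
  map_zero' := eq_of_forall_lift fun C _ x hx => by simp only [lift_mk_X, map_zero]
  map_mul' a b := eq_of_forall_lift fun C _ x hx => by simp only [lift_mk_X, map_mul]
  map_add' a b := eq_of_forall_lift fun C _ x hx => by simp only [lift_mk_X, map_add]

@[simp]
theorem lift_vertex (x : Fin (n + 1) → A →+* C) (hx : IsRingSimplex φ x) (i : Fin (n + 1))
    (a : A) : lift x hx (vertex φ i a) = x i a :=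
  lift_mk_X x hx i a

variable (φ n) in
theorem isRingSimplex_vertex : IsRingSimplex φ (vertex φ : Fin (n + 1) → _) where
  comp_eq i j k := eq_of_forall_lift fun C _ x hx => by
    simpa only [lift_vertex] using hx.comp_eq i j k
  sq_zero i j a b := eq_of_forall_lift fun C _ x hx => by
    simpa only [map_mul, map_sub, map_zero, lift_vertex] using hx.sq_zero i j a b
  strong i j b := eq_of_forall_lift fun C _ x hx => by
    simpa only [map_mul, map_sub, map_zero, lift_vertex] using hx.strong i j b

theorem hom_ext {B : Type*} [CommRing B] {g h : SimplexRing φ n →+* B}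
    (H : ∀ i a, g (vertex φ i a) = h (vertex φ i a)) : g = h := by
  refine Ideal.Quotient.ringHom_ext (MvPolynomial.ringHom_ext (fun r => ?_) fun s => H s.1 s.2)
  simp

theorem sub_mem_of_forall_vertex {B : Type*} [CommRing B] {g h : SimplexRing φ n →+* B}
    {I : Ideal B} (H : ∀ i a, g (vertex φ i a) - h (vertex φ i a) ∈ I) (r : SimplexRing φ n) :
    g r - h r ∈ I :=
  Ideal.Quotient.eq.mp <| RingHom.congr_fun
    (hom_ext (g := (Ideal.Quotient.mk I).comp g) (h := (Ideal.Quotient.mk I).comp h)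
      fun i a => Ideal.Quotient.eq.mpr (H i a)) r

variable (φ) in
/-- The homomorphism induced by `(x_0, …, x_n) ↦ (x_{α 0}, …, x_{α m})`. -/
noncomputable def reindex (α : Fin (m + 1) → Fin (n + 1)) : SimplexRing φ m →+* SimplexRing φ n :=
  lift (fun i => vertex φ (α i)) ((isRingSimplex_vertex φ n).reindex α)

@[simp]
theorem reindex_vertex (α : Fin (m + 1) → Fin (n + 1)) (i : Fin (m + 1)) (a : A) :
    reindex φ α (vertex φ i a) = vertex φ (α i) a :=
  lift_vertex _ _ i a

variable (φ) in
/-- The ideal of the partial diagonal `x_i = x_j`. -/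
noncomputable def diagIdeal (i j : Fin (n + 1)) : Ideal (SimplexRing φ n) :=
  Ideal.span (Set.range fun a => vertex φ j a - vertex φ i a)

theorem vertex_sub_mem (i j : Fin (n + 1)) (a : A) :
    vertex φ j a - vertex φ i a ∈ diagIdeal φ i j :=
  Ideal.subset_span ⟨a, rfl⟩

theorem mul_eq_zero_of_mem_diagIdeal {i j : Fin (n + 1)} {r s : SimplexRing φ n}
    (hr : r ∈ diagIdeal φ i j) (hs : s ∈ diagIdeal φ i j) : r * s = 0 := by
  have h : diagIdeal φ i j * diagIdeal φ i j ≤ ⊥ := by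
    rw [diagIdeal, Ideal.span_mul_span', Ideal.span_le]
    rintro _ ⟨_, ⟨a, rfl⟩, _, ⟨b, rfl⟩, rfl⟩
    exact (isRingSimplex_vertex φ n).sq_zero i j a b
  exact h (Ideal.mul_mem_mul hr hs)

/-- The difference is square-zero on the generators, and the nilradical is an ideal. It follows that
all reindexings induce the same map on underlying spaces. -/
theorem reindex_sub_reindex_mem_nilradical (α β : Fin (m + 1) → Fin (n + 1))
    (r : SimplexRing φ m) : reindex φ α r - reindex φ β r ∈ nilradical (SimplexRing φ n) := by
  refine sub_mem_of_forall_vertex (fun i a => ?_) r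
  rw [reindex_vertex, reindex_vertex, mem_nilradical]
  exact ⟨2, by rw [sq, (isRingSimplex_vertex φ n).sq_zero]⟩

theorem reindex_id (r : SimplexRing φ n) : reindex φ id r = r :=
  RingHom.congr_fun (hom_ext (g := reindex φ id) (h := RingHom.id _) fun i a => by simp) r

theorem sub_reindex_mem {I : Ideal (SimplexRing φ n)} {α : Fin (n + 1) → Fin (n + 1)}
    (H : ∀ i a, vertex φ i a - vertex φ (α i) a ∈ I) (r : SimplexRing φ n) :
    r - reindex φ α r ∈ I :=
  sub_mem_of_forall_vertex (g := RingHom.id _) (fun i a => by simpa using H i a) r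

/-- A function on `Δ²` vanishing on the diagonal `y = z` changes sign when `y` and `z` are
exchanged. -/
theorem add_swap_eq_zero {F : SimplexRing φ 2} (hF : (reindex φ ![0, 1, 1] F : SimplexRing φ 2) = 0) :
    F + reindex φ ![0, 2, 1] F = 0 := by
  have hm : F ∈ diagIdeal φ 1 2 := by
    rw [← sub_zero F, ← hF]
    refine sub_reindex_mem (fun i a => ?_) F
    fin_cases i
    · simp
    · simp
    · exact vertex_sub_mem 1 2 a
  have hs : ∀ c : SimplexRing φ 2, c - reindex φ ![0, 2, 1] c ∈ diagIdeal φ 1 2 := by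
    refine sub_reindex_mem fun i a => ?_
    fin_cases i
    · simp
    · rw [← neg_sub]
      exact neg_mem (vertex_sub_mem 1 2 a)
    · exact vertex_sub_mem 1 2 a
  clear hF
  refine Submodule.span_induction (p := fun F _ => F + reindex φ ![0, 2, 1] F = 0)
    ?_ ?_ ?_ ?_ hm
  · rintro _ ⟨a, rfl⟩
    simp
  · simp
  · intro r s _ _ hr hs
    rw [map_add]
    linear_combination hr + hs
  -- With σ the swap, cr + σ(c)σ(r) = (c - σ(c)) r + σ(c)(r + σ(r)); the first term is a product of
  -- two elements of the square-zero ideal.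
  · intro c r hr h
    rw [smul_eq_mul, map_mul]
    linear_combination mul_eq_zero_of_mem_diagIdeal (hs c) hr + reindex φ ![0, 2, 1] c * h

/-- A function on `Δ³` vanishing on the diagonals `x_1 = x_2` and `x_1 = x_3` vanishes on the
diagonal `x_2 = x_3`. -/
theorem reindex_eq_zero {F : SimplexRing φ 3} (h₂ : (reindex φ ![0, 1, 1, 3] F : SimplexRing φ 3) = 0)
    (h₃ : (reindex φ ![0, 1, 2, 1] F : SimplexRing φ 3) = 0) :
    (reindex φ ![0, 1, 2, 2] F : SimplexRing φ 2) = 0 := by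
  have hm : F ∈ diagIdeal φ 1 2 := by
    rw [← sub_zero F, ← h₂]
    refine sub_reindex_mem (fun i a => ?_) F
    fin_cases i
    · simp
    · simp
    · exact vertex_sub_mem 1 2 a
    · simp
  have hq : ∀ r ∈ diagIdeal (n := 3) φ 1 2, reindex φ ![0, 1, 2, 2] r ∈
      diagIdeal (n := 2) φ 1 2 := by
    intro r hr
    refine Submodule.span_induction
      (p := fun r _ => reindex φ ![0, 1, 2, 2] r ∈ diagIdeal (n := 2) φ 1 2) ?_ ?_ ?_ ?_ hr
    · rintro _ ⟨a, rfl⟩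
      simpa using vertex_sub_mem 1 2 a
    · simp
    · intro r s _ _ hr hs
      rw [map_add]
      exact add_mem hr hs
    · intro c r _ h
      rw [smul_eq_mul, map_mul]
      exact Ideal.mul_mem_left _ _ h
  have hc : ∀ c : SimplexRing φ 3,
      reindex φ ![0, 1, 2, 2] c - reindex φ ![0, 1, 2, 2] (reindex φ ![0, 1, 2, 1] c) ∈
        diagIdeal (n := 2) φ 1 2 := by
    refine sub_mem_of_forall_vertex (h := (reindex φ ![0, 1, 2, 2]).comp (reindex φ _))
      fun i a => ?_
    fin_cases i
    · simp
    · simp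
    · simp
    · simpa using vertex_sub_mem 1 2 a
  -- On the ideal of x_1 = x_2, restricting to x_3 = x_2 and to x_3 = x_1 give the same result in
  -- Δ²: the two restrictions of a coefficient differ by an element of the ideal of x_1 = x_2, which
  -- kills the other factor. The second restriction of F is zero by `h₃`.
  suffices h : reindex φ ![0, 1, 2, 2] F -
      (reindex φ ![0, 1, 2, 2] (reindex φ ![0, 1, 2, 1] F) : SimplexRing φ 2) = 0 by
    rwa [h₃, map_zero, sub_zero] at h
  clear h₂ h₃
  refine Submodule.span_induction (p := fun F _ => reindex φ ![0, 1, 2, 2] F -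
    reindex φ ![0, 1, 2, 2] (reindex φ ![0, 1, 2, 1] F) = 0) ?_ ?_ ?_ ?_ hm
  · rintro _ ⟨a, rfl⟩
    simp
  · simp
  · intro r s _ _ hr hs
    simp only [map_add]
    linear_combination hr + hs
  · intro c r hr h
    simp only [smul_eq_mul, map_mul]
    linear_combination mul_eq_zero_of_mem_diagIdeal (hc c) (hq r hr) +
      reindex φ ![0, 1, 2, 2] (reindex φ ![0, 1, 2, 1] c) * h

end SimplexRing

end SimplexRing

/-! ### Localization, and passage from rings to schemes. -/

/-- Denominators are cleared: for u = a/σ, multiplying the difference of two values of u by a unit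
expresses it through differences of a and of σ. -/
theorem IsRingSimplex.of_isLocalization {K A B C : Type u} [CommRing K] [CommRing A] [CommRing B]
    [CommRing C] [Algebra A B] (M : Submonoid A) [IsLocalization M B] {φ : K →+* A} {n : ℕ}
    {z : Fin (n + 1) → B →+* C} (hz : IsRingSimplex φ fun i => (z i).comp (algebraMap A B)) :
    IsRingSimplex ((algebraMap A B).comp φ) z := by
  have hsq : ∀ i j a b, (z j (algebraMap A B a) - z i (algebraMap A B a)) *
    (z j (algebraMap A B b) - z i (algebraMap A B b)) = 0 := hz.sq_zero
  have hst : ∀ i j a, (z i (algebraMap A B a) - z 0 (algebraMap A B a)) *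
    (z j (algebraMap A B a) - z 0 (algebraMap A B a)) = 0 := hz.strong
  have hsq' : ∀ i j a b, (z j a - z i a) * (z j b - z i b) = 0 := by
    intro i j u v
    obtain ⟨⟨a, σ⟩, hu⟩ := IsLocalization.surj M u
    obtain ⟨⟨b, τ⟩, hv⟩ := IsLocalization.surj M v
    have key : ∀ (u : B) (a : A) (σ : M), u * algebraMap A B σ = algebraMap A B a →
        z j (algebraMap A B σ) * (z j u - z i u) =
          (z j (algebraMap A B a) - z i (algebraMap A B a)) -
            z i u * (z j (algebraMap A B σ) - z i (algebraMap A B σ)) := by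
      intro u a σ h
      rw [← h, map_mul, map_mul]
      ring
    refine ((IsLocalization.map_units B σ).map (z j)).mul_left_cancel ?_
    refine ((IsLocalization.map_units B τ).map (z j)).mul_left_cancel ?_
    linear_combination (z j (algebraMap A B τ) * (z j v - z i v)) * key u a σ hu +
      (z j (algebraMap A B a) - z i (algebraMap A B a) -
            z i u * (z j (algebraMap A B σ) - z i (algebraMap A B σ))) * key v b τ hv +
      hsq i j a b - z i u * hsq i j σ b - z i v * hsq i j a τ + z i u * z i v * hsq i j σ τ
  refine ⟨hz.comp_eq, hsq', fun i j u => ?_⟩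
  obtain ⟨⟨a, σ⟩, hu⟩ := IsLocalization.surj M u
  have key : ∀ i, z 0 (algebraMap A B σ) * (z i u - z 0 u) =
      (z i (algebraMap A B a) - z 0 (algebraMap A B a)) -
        z 0 u * (z i (algebraMap A B σ) - z 0 (algebraMap A B σ)) := by
    intro i
    rw [← hu, map_mul, map_mul]
    linear_combination -hsq' 0 i u (algebraMap A B σ)
  -- The strong equation involves a single function; polarization at a + σ supplies the mixed terms
  -- in a and σ.
  have hpol := hst i j (a + σ)
  simp only [map_add] at hpol
  refine ((IsLocalization.map_units B σ).map (z 0)).mul_left_cancel ?_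
  refine ((IsLocalization.map_units B σ).map (z 0)).mul_left_cancel ?_
  linear_combination (z 0 (algebraMap A B σ) * (z j u - z 0 u)) * key i +
    (z i (algebraMap A B a) - z 0 (algebraMap A B a) -
      z 0 u * (z i (algebraMap A B σ) - z 0 (algebraMap A B σ))) * key j +
    (1 + z 0 u) * hst i j a - z 0 u * hpol + (z 0 u + z 0 u * z 0 u) * hst i j σ

theorem IsRingSimplex.comp {K A C D : Type u} [CommRing K] [CommRing A]
    [CommRing C] [CommRing D] {φ : K →+* A} {n : ℕ} {x : Fin (n + 1) → A →+* C}
    (hx : IsRingSimplex φ x) (g : C →+* D) : IsRingSimplex φ fun i => g.comp (x i) where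
  comp_eq i j k := congrArg g (hx.comp_eq i j k)
  sq_zero i j a b := by
    simp only [RingHom.comp_apply, ← map_sub, ← map_mul, hx.sq_zero, map_zero]
  strong i j b := by
    simp only [RingHom.comp_apply, ← map_sub, ← map_mul, hx.strong, map_zero]

theorem section_eq_zero_of_locally {T : Scheme.{u}} {V : T.Opens} (s : Γ(T, V))
    (h : ∀ t ∈ V, ∃ (V' : T.Opens) (i : V' ≤ V), t ∈ V' ∧ T.presheaf.map (homOfLE i).op s = 0) :
    s = 0 := by
  refine TopCat.Presheaf.section_ext T.sheaf V s 0 fun t ht => ?_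
  obtain ⟨V', i, ht', hs⟩ := h t ht
  have := T.presheaf.germ_res_apply (homOfLE i) t ht' s
  rw [hs] at this
  rw [map_zero] at this
  exact this.symm.trans (map_zero _).symm

/-- For points of an affine open subscheme, the equations defining infinitesimal simplices need
only be checked on its coordinate ring. -/
theorem isInfSimplex_of_isRingSimplex {T X : Scheme.{u}} {n : ℕ} {x : Fin (n + 1) → (T ⟶ X)}
    (hbase : ∀ i j, (x i).base = (x j).base) {U : X.Opens} (hU : IsAffineOpen U)
    (h : ∀ i, ⊤ ≤ x i ⁻¹ᵁ U) {K : Type u} [CommRing K] {φ : K →+* Γ(X, U)}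
    (hx : IsRingSimplex φ fun i => ((x i).appLE U ⊤ (h i)).hom) : IsInfSimplex x := by
  have hle : ∀ i j {U' : X.Opens} {V : T.Opens}, V ≤ x i ⁻¹ᵁ U' → V ≤ x j ⁻¹ᵁ U' := by
    intro i j U' V hV t ht
    have := hV ht
    change (x j).base t ∈ U'
    rw [← hbase i]
    exact this
  have loc : ∀ (U' : X.Opens) (V : T.Opens), (∀ i, V ≤ x i ⁻¹ᵁ U') → ∀ t ∈ V,
      ∃ (V' : T.Opens) (_ : V' ≤ V) (D : X.Opens) (_ : D ≤ U') (hD : ∀ i, V' ≤ x i ⁻¹ᵁ D)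
        (ψ : K →+* Γ(X, D)), t ∈ V' ∧
          IsRingSimplex ψ fun i => ((x i).appLE D V' (hD i)).hom := by
    intro U' V hV t ht
    -- The open U' is arbitrary, but near the point it contains a basic open of U, whose ring is a
    -- localization of Γ(X, U).
    obtain ⟨s, hs, hts⟩ := hU.exists_basicOpen_le ⟨x 0 t, hV 0 ht⟩ (h 0 (show t ∈ ⊤ from trivial))
    have hD : ∀ i, V ⊓ x 0 ⁻¹ᵁ X.basicOpen s ≤ x i ⁻¹ᵁ X.basicOpen s := fun i =>
      hle 0 i inf_le_right
    have := hU.isLocalization_basicOpen s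
    refine ⟨V ⊓ x 0 ⁻¹ᵁ X.basicOpen s, inf_le_left, X.basicOpen s, hs, hD, _, ⟨ht, hts⟩,
      IsRingSimplex.of_isLocalization (φ := φ) (.powers s) ?_⟩
    convert hx.comp (T.presheaf.map (homOfLE (le_top : V ⊓ x 0 ⁻¹ᵁ X.basicOpen s ≤ ⊤)).op).hom
      using 2 with i
    rw [← CommRingCat.hom_comp, Scheme.Hom.appLE_map]
    change (X.presheaf.map (homOfLE (X.basicOpen_le s)).op ≫ (x i).appLE _ _ _).hom = _
    rw [Scheme.Hom.map_appLE]
  have res : ∀ {U' D : X.Opens} {V V' : T.Opens} (i : Fin (n + 1)) (hV : V ≤ x i ⁻¹ᵁ U')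
      (hV' : V' ≤ x i ⁻¹ᵁ D) (j : V' ≤ V) (k : D ≤ U') (b : Γ(X, U')),
      T.presheaf.map (homOfLE j).op ((x i).appLE U' V hV b) =
        (x i).appLE D V' hV' (X.presheaf.map (homOfLE k).op b) := by
    intro U' D V V' i hV hV' j k b
    rw [← ConcreteCategory.comp_apply, ← ConcreteCategory.comp_apply, Scheme.Hom.appLE_map,
      Scheme.Hom.map_appLE]
  refine ⟨hbase, fun i j U' V hi hj a b => ?_, fun i j U' V h0 hi hj b => ?_⟩
  · refine section_eq_zero_of_locally _ fun t ht => ?_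
    obtain ⟨V', k, D, l, hD, ψ, ht', hψ⟩ := loc U' V (fun m => hle i m hi) t ht
    refine ⟨V', k, ht', ?_⟩
    rw [map_mul, map_sub, map_sub, res i hi (hD i) k l, res j hj (hD j) k l,
      res i hi (hD i) k l, res j hj (hD j) k l]
    exact hψ.sq_zero i j _ _
  · refine section_eq_zero_of_locally _ fun t ht => ?_
    obtain ⟨V', k, D, l, hD, ψ, ht', hψ⟩ := loc U' V (fun m => hle i m hi) t ht
    refine ⟨V', k, ht', ?_⟩
    rw [map_mul, map_sub, map_sub, res i hi (hD i) k l, res j hj (hD j) k l,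
      res 0 h0 (hD 0) k l]
    exact hψ.strong i j _

/-! ### Points of an affine open with values in affine schemes. -/

section SpecPoint

variable {X : Scheme.{u}} {U : X.Opens}

/-- The point of `X` with values in an affine scheme, lying in the affine open `U`, given by a
homomorphism out of the coordinate ring of `U`. -/
noncomputable def specPoint (hU : IsAffineOpen U) {C : Type u} [CommRing C] (a : Γ(X, U) →+* C) :
    Spec (.of C) ⟶ X :=
  Spec.map (CommRingCat.ofHom a) ≫ hU.fromSpec

theorem le_preimage_specPoint (hU : IsAffineOpen U) {C : Type u} [CommRing C] (a : Γ(X, U) →+* C) :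
    ⊤ ≤ specPoint hU a ⁻¹ᵁ U := by
  rw [specPoint, Scheme.Hom.comp_preimage, hU.fromSpec_preimage_self]
  rfl

theorem appLE_specPoint (hU : IsAffineOpen U) {C : Type u} [CommRing C] (a : Γ(X, U) →+* C) :
    (specPoint hU a).appLE U ⊤ (le_preimage_specPoint hU a) =
      CommRingCat.ofHom a ≫ (Scheme.ΓSpecIso (.of C)).inv := by
  have e : hU.fromSpec.appLE U ⊤ hU.fromSpec_preimage_self.ge =
      (Scheme.ΓSpecIso Γ(X, U)).inv := by
    rw [Scheme.Hom.appLE, hU.fromSpec_app_self, Category.assoc, ← Functor.map_comp]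
    exact (congrArg _ ((Spec Γ(X, U)).presheaf.map_id _)).trans (Category.comp_id _)
  rw [Scheme.ΓSpecIso_inv_naturality]
  change _ = (Scheme.ΓSpecIso Γ(X, U)).inv ≫ _
  rw [← e, Scheme.Hom.appTop, Scheme.Hom.app_eq_appLE]
  exact (Scheme.Hom.appLE_comp_appLE _ _ _ _ _ _ _).symm

theorem specMap_specPoint (hU : IsAffineOpen U) {C D : Type u} [CommRing C] [CommRing D] (a : Γ(X, U) →+* C)
    (g : C →+* D) : Spec.map (CommRingCat.ofHom g) ≫ specPoint hU a = specPoint hU (g.comp a) := by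
  rw [specPoint, specPoint, CommRingCat.ofHom_comp, Spec.map_comp, Category.assoc]

theorem toSpecΓ_specPoint (hU : IsAffineOpen U) {T : Scheme.{u}} (f : T ⟶ X) (V : T.Opens) (h : V ≤ f ⁻¹ᵁ U) :
    V.toSpecΓ ≫ specPoint hU (f.appLE U V h).hom = V.ι ≫ f := by
  rw [specPoint]
  change V.toSpecΓ ≫ Spec.map (f.appLE U V h) ≫ _ = _
  rw [Scheme.Opens.toSpecΓ_SpecMap_appLE_assoc, hU.toSpecΓ_fromSpec, Scheme.Hom.resLE_comp_ι]

theorem hom_ext_of_appLE_eq (hU : IsAffineOpen U) {T : Scheme.{u}} {f g : T ⟶ X} (hf : ⊤ ≤ f ⁻¹ᵁ U)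
    (hg : ⊤ ≤ g ⁻¹ᵁ U) (h : f.appLE U ⊤ hf = g.appLE U ⊤ hg) : f = g := by
  refine Scheme.hom_ext_of_forall f g fun t => ⟨⊤, trivial, ?_⟩
  rw [← toSpecΓ_specPoint hU f ⊤ hf, h, toSpecΓ_specPoint]

theorem specMap_base_eq {C D : Type u} [CommRing C] [CommRing D] {f g : C →+* D}
    (h : ∀ c, f c - g c ∈ nilradical D) :
    (Spec.map (CommRingCat.ofHom f)).base = (Spec.map (CommRingCat.ofHom g)).base := by
  ext p
  refine PrimeSpectrum.ext (Ideal.ext fun c => ?_)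
  change f c ∈ p.asIdeal ↔ g c ∈ p.asIdeal
  have hle : nilradical D ≤ p.asIdeal := @nilradical_le_prime D _ p.asIdeal p.isPrime
  have hp : f c - g c ∈ p.asIdeal := hle (h c)
  exact ⟨fun hf => by simpa using sub_mem hf hp, fun hg => by simpa using add_mem hp hg⟩

theorem isInfSimplex_specPoint (hU : IsAffineOpen U) {K C : Type u} [CommRing K] [CommRing C] {n : ℕ}
    {φ : K →+* Γ(X, U)} {x : Fin (n + 1) → Γ(X, U) →+* C} (hx : IsRingSimplex φ x) :
    IsInfSimplex fun i => specPoint hU (x i) := by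
  refine isInfSimplex_of_isRingSimplex (fun i j => ?_) hU
    (fun i => le_preimage_specPoint hU (x i)) (φ := φ) ?_
  · rw [specPoint, specPoint, Scheme.Hom.comp_base, Scheme.Hom.comp_base,
      specMap_base_eq fun c => ?_]
    rw [mem_nilradical]
    exact ⟨2, by rw [sq, hx.sq_zero]⟩
  · simp only [appLE_specPoint]
    exact hx.comp (Scheme.ΓSpecIso (.of C)).inv.hom

end SpecPoint

/-! ### The universal simplex over an affine open. -/

section UniversalSimplex

variable {S : Scheme.{u}} {X : Over S} {V : S.Opens} {U : X.left.Opens} (hU : IsAffineOpen U)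
  (hUV : U ≤ X.hom ⁻¹ᵁ V)

/-- The homomorphism of coordinate rings induced by the structure morphism of `X`. -/
noncomputable abbrev structureHom : Γ(S, V) →+* Γ(X.left, U) := (X.hom.appLE V U hUV).hom

theorem specPoint_comp_hom (hV : IsAffineOpen V) {C : Type u} [CommRing C] (a : Γ(X.left, U) →+* C) :
    specPoint hU a ≫ X.hom = specPoint hV (a.comp (structureHom hUV)) := by
  rw [← specMap_specPoint, specPoint, Category.assoc, specPoint]
  congr 1
  exact (IsAffineOpen.SpecMap_appLE_fromSpec X.hom hV hU hUV).symm

/-- Agreement on Γ(S, V) makes all vertices morphisms over S for one common structure morphism. -/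
theorem IsRingSimplex.specPoint_comp_hom_eq (hV : IsAffineOpen V) {C : Type u} [CommRing C] {n : ℕ}
    {x : Fin (n + 1) → Γ(X.left, U) →+* C} (hx : IsRingSimplex (structureHom hUV) x)
    (i j : Fin (n + 1)) : specPoint hU (x i) ≫ X.hom = specPoint hU (x j) ≫ X.hom := by
  rw [specPoint_comp_hom hU hUV hV, specPoint_comp_hom hU hUV hV]
  congr 1
  exact RingHom.ext (hx.comp_eq i j)

/-- The scheme of infinitesimal simplices of an affine open subscheme. -/
noncomputable def simplexScheme (n : ℕ) : Over S :=
  Over.mk (specPoint hU (SimplexRing.vertex (n := n) (structureHom hUV) 0) ≫ X.hom)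

/-- The universal infinitesimal simplex of an affine open subscheme. -/
noncomputable def universalSimplex (hV : IsAffineOpen V) (n : ℕ) : Simplex X n (simplexScheme hU hUV n) where
  vertex i := Over.homMk (specPoint hU (SimplexRing.vertex (structureHom hUV) i))
    ((SimplexRing.isRingSimplex_vertex _ n).specPoint_comp_hom_eq hU hUV hV i 0)
  isInf := isInfSimplex_specPoint hU (SimplexRing.isRingSimplex_vertex (structureHom hUV) n)

/-- The morphism `(x_0, …, x_n) ↦ (x_{α 0}, …, x_{α m})` of schemes of simplices. -/
noncomputable def simplexSchemeMap (hV : IsAffineOpen V) {m n : ℕ} (α : Fin (m + 1) → Fin (n + 1)) :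
    simplexScheme hU hUV n ⟶ simplexScheme hU hUV m :=
  Over.homMk (Spec.map (CommRingCat.ofHom (SimplexRing.reindex (structureHom hUV) α))) <| by
    have e : (SimplexRing.reindex (structureHom hUV) α).comp
        (SimplexRing.vertex (structureHom hUV) 0) = SimplexRing.vertex (structureHom hUV) (α 0) :=
      RingHom.ext fun a => SimplexRing.reindex_vertex α 0 a
    change Spec.map _ ≫ specPoint hU _ ≫ X.hom = specPoint hU _ ≫ X.hom
    rw [← Category.assoc, specMap_specPoint, e]
    exact (SimplexRing.isRingSimplex_vertex _ n).specPoint_comp_hom_eq hU hUV hV (α 0) 0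

theorem universalSimplex_precomp (hV : IsAffineOpen V) {m n : ℕ} (α : Fin (m + 1) → Fin (n + 1)) :
    (universalSimplex hU hUV hV m).precomp (simplexSchemeMap hU hUV hV α) =
      (universalSimplex hU hUV hV n).proj α := by
  refine Simplex.ext_vertex fun i => Over.OverMorphism.ext ?_
  refine (specMap_specPoint hU _ _).trans ?_
  exact congrArg (specPoint hU) (RingHom.ext fun a => SimplexRing.reindex_vertex α i a)

/-- Every infinitesimal simplex is locally a pullback of the universal one. -/
theorem exists_precomp_eq (hV : IsAffineOpen V) {n : ℕ} {T : Over S} (x : Simplex X n T) (T' : T.left.Opens)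
    (h : ∀ i, T' ≤ (x.vertex i).left ⁻¹ᵁ U) :
    ∃ g : Over.mk (T'.ι ≫ T.hom) ⟶ simplexScheme hU hUV n,
      x.precomp (Over.homMk T'.ι) = (universalSimplex hU hUV hV n).precomp g := by
  have hx : IsRingSimplex (structureHom hUV) fun i =>
      ((x.vertex i).left.appLE U T' (h i)).hom := by
    refine ⟨fun i j k => ?_, fun i j a b => x.isInf.sq_zero i j U T' (h i) (h j) a b,
      fun i j b => x.isInf.strong i j U T' (h 0) (h i) (h j) b⟩
    have e : ∀ i, X.hom.appLE V U hUV ≫ (x.vertex i).left.appLE U T' (h i) =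
        T.hom.appLE V T' (by
          rw [← Over.w (x.vertex i)]
          exact (h i).trans ((x.vertex i).left.preimage_mono hUV)) := by
      intro i
      rw [Scheme.Hom.appLE_comp_appLE]
      simp only [Over.w]
    exact ConcreteCategory.congr_hom ((e i).trans (e j).symm) k
  have key : ∀ i, (T'.toSpecΓ ≫ Spec.map (CommRingCat.ofHom (SimplexRing.lift _ hx))) ≫
      specPoint hU (SimplexRing.vertex (structureHom hUV) i) = T'.ι ≫ (x.vertex i).left := by
    intro i
    rw [Category.assoc, specMap_specPoint, ← toSpecΓ_specPoint hU _ T' (h i)]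
    congr 2
    exact RingHom.ext fun a => SimplexRing.lift_vertex _ hx i a
  refine ⟨Over.homMk (T'.toSpecΓ ≫ Spec.map (CommRingCat.ofHom (SimplexRing.lift _ hx))) ?_, ?_⟩
  · have := congrArg (· ≫ X.hom) (key 0)
    refine (Category.assoc _ _ _).symm.trans (this.trans ?_)
    change (T'.ι ≫ _) ≫ X.hom = T'.ι ≫ T.hom
    rw [Category.assoc, Over.w]
  · exact Simplex.ext_vertex fun i => Over.OverMorphism.ext (key i).symm

end UniversalSimplex

/-! ### Values near the unit section, and alternation of 2-forms. -/

section Values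

open scoped MonObj

variable {S : Scheme.{u}} {X G : Over S} {V : S.Opens} {U : X.left.Opens} {hU : IsAffineOpen U} {hUV : U ≤ X.hom ⁻¹ᵁ V} (W : G.left.Opens)

/-- The coordinates of a morphism from a scheme of simplices to an open subscheme. -/
noncomputable def coordHom {n : ℕ} (g : simplexScheme hU hUV n ⟶ G) (h : ⊤ ≤ g.left ⁻¹ᵁ W) :
    Γ(G.left, W) →+* SimplexRing (structureHom hUV) n :=
  (Scheme.ΓSpecIso (.of (SimplexRing (structureHom hUV) n))).hom.hom.comp
    (g.left.appLE W ⊤ h).hom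

variable {W}

theorem eq_of_coordHom_eq (hW : IsAffineOpen W) {n : ℕ} {g g' : simplexScheme hU hUV n ⟶ G}
    (h : ⊤ ≤ g.left ⁻¹ᵁ W) (h' : ⊤ ≤ g'.left ⁻¹ᵁ W)
    (e : ∀ f, coordHom W g h f = coordHom W g' h' f) : g = g' := by
  refine Over.OverMorphism.ext (hom_ext_of_appLE_eq hW h h' ?_)
  ext f
  exact (ConcreteCategory.bijective_of_isIso
    (Scheme.ΓSpecIso (.of (SimplexRing (structureHom hUV) n))).hom).1 (e f)

theorem coordHom_simplexSchemeMap (hV : IsAffineOpen V) {m n : ℕ} (α : Fin (m + 1) → Fin (n + 1))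
    (g : simplexScheme hU hUV m ⟶ G) (h : ⊤ ≤ g.left ⁻¹ᵁ W)
    {g' : simplexScheme hU hUV n ⟶ G} (h' : ⊤ ≤ g'.left ⁻¹ᵁ W)
    (e : simplexSchemeMap hU hUV hV α ≫ g = g') (f : Γ(G.left, W)) :
    SimplexRing.reindex (structureHom hUV) α (coordHom W g h f) = coordHom W g' h' f := by
  subst e
  have e₁ : (simplexSchemeMap hU hUV hV α ≫ g).left.appLE W ⊤ h' =
      g.left.appLE W ⊤ h ≫
        (Spec.map (CommRingCat.ofHom (SimplexRing.reindex (structureHom hUV) α))).appTop := by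
    rw [Scheme.Hom.appTop, Scheme.Hom.app_eq_appLE]
    exact (Scheme.Hom.appLE_comp_appLE _ _ _ _ _ _ _).symm
  have e₂ := ConcreteCategory.congr_hom (Scheme.ΓSpecIso_naturality
    (CommRingCat.ofHom (SimplexRing.reindex (structureHom hUV) α) :
      .of (SimplexRing _ m) ⟶ .of (SimplexRing _ n))) (g.left.appLE W ⊤ h f)
  refine e₂.symm.trans ?_
  rw [coordHom, e₁]
  rfl

variable [GrpObj G]

theorem one_left_eq (T : Over S) :
    (1 : T ⟶ G).left = T.hom ≫ (1 : Over.mk (𝟙 S) ⟶ G).left := by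
  rw [← MonObj.comp_one (M := G) (Over.homMk T.hom : T ⟶ Over.mk (𝟙 S))]
  rfl

theorem le_preimage_one (hW : V ≤ (1 : Over.mk (𝟙 S) ⟶ G).left ⁻¹ᵁ W) (n : ℕ) :
    ⊤ ≤ (1 : simplexScheme hU hUV n ⟶ G).left ⁻¹ᵁ W := by
  rw [one_left_eq]
  intro t _
  exact hW (hUV (le_preimage_specPoint hU (SimplexRing.vertex (structureHom hUV) 0)
    (show t ∈ ⊤ from trivial)))

/-- A morphism to a group scheme which is trivial on the diagonal takes its values in any
neighbourhood of the unit section. -/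
theorem le_preimage_of_diagonal (hV : IsAffineOpen V) (hW : V ≤ (1 : Over.mk (𝟙 S) ⟶ G).left ⁻¹ᵁ W) {n : ℕ}
    {g : simplexScheme hU hUV n ⟶ G}
    (hg : simplexSchemeMap hU hUV hV (fun _ : Fin (n + 1) => (0 : Fin (n + 1))) ≫ g = 1) :
    ⊤ ≤ g.left ⁻¹ᵁ W := by
  -- Collapsing all vertices to x_0 changes functions by nilpotents only, so it is the identity on
  -- points; hence g and the unit have the same underlying map.
  have e : (Spec.map (CommRingCat.ofHom (SimplexRing.reindex (structureHom hUV)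
      fun _ : Fin (n + 1) => (0 : Fin (n + 1))))).base = 𝟙 _ := by
    rw [specMap_base_eq (g := RingHom.id _), CommRingCat.ofHom_id, Spec.map_id]
    · rfl
    · intro c
      have := SimplexRing.reindex_sub_reindex_mem_nilradical (fun _ => (0 : Fin (n + 1))) id c
      rwa [SimplexRing.reindex_id] at this
  intro t _
  have ht := le_preimage_one hW n (show t ∈ ⊤ from trivial)
  rw [← hg] at ht
  have ht' : g.left.base ((Spec.map (CommRingCat.ofHom (SimplexRing.reindex (structureHom hUV)
      fun _ : Fin (n + 1) => (0 : Fin (n + 1))))).base t) ∈ W := ht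
  rw [e] at ht'
  exact ht'

/-- The value of a cochain with values in a group scheme, as a morphism of schemes. -/
def Cochain.evalHom {k : ℕ} (ω : Cochain X k (yonedaGrpObj G)) {T : Over S}
    (x : Simplex X k T) : T ⟶ G :=
  ω.eval x

theorem Cochain.comp_evalHom {k : ℕ} (ω : Cochain X k (yonedaGrpObj G)) {T T' : Over S}
    (f : T' ⟶ T) (x : Simplex X k T) : f ≫ ω.evalHom x = ω.evalHom (x.precomp f) :=
  ω.natural f x

variable (hU hUV) in
theorem evalHom_universalSimplex (hV : IsAffineOpen V) (hW : IsAffineOpen W)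
    (hVW : V ≤ (1 : Over.mk (𝟙 S) ⟶ G).left ⁻¹ᵁ W) {ω : Cochain X 2 (yonedaGrpObj G)}
    (hω : ω.IsForm) :
    ω.evalHom ((universalSimplex hU hUV hV 2).proj ![0, 1, 2]) *
      ω.evalHom ((universalSimplex hU hUV hV 2).proj ![0, 2, 1]) = 1 := by
  let v (n : ℕ) (i j k : Fin (n + 1)) : simplexScheme hU hUV n ⟶ G :=
    ω.evalHom ((universalSimplex hU hUV hV n).proj ![i, j, k])
  have hv {m n : ℕ} (α : Fin (m + 1) → Fin (n + 1)) (i j k : Fin (m + 1)) :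
      simplexSchemeMap hU hUV hV α ≫ v m i j k = v n (α i) (α j) (α k) := by
    refine (ω.comp_evalHom _ _).trans ?_
    rw [← Simplex.precomp_proj, universalSimplex_precomp]
    refine congrArg (fun x => ω.evalHom x) (Simplex.ext_vertex fun l => ?_)
    fin_cases l <;> rfl
  have hdeg {n : ℕ} (i j : Fin (n + 1)) : v n i j j = 1 := hω _ 1 rfl
  have hv_le {n : ℕ} (i j k : Fin (n + 1)) : ⊤ ≤ (v n i j k).left ⁻¹ᵁ W :=
    le_preimage_of_diagonal hV hVW (by rw [hv, hdeg])
  have hvv_le {n : ℕ} (i j k i' j' k' : Fin (n + 1)) :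
      ⊤ ≤ (v n i j k * v n i' j' k').left ⁻¹ᵁ W :=
    le_preimage_of_diagonal hV hVW (by rw [MonObj.comp_mul, hv, hv, hdeg, mul_one])
  have h1_le (n : ℕ) := le_preimage_one (hU := hU) (hUV := hUV) hVW n
  refine eq_of_coordHom_eq hW (hvv_le 0 1 2 0 2 1) (h1_le 2) fun f => ?_
  let c (n : ℕ) (i j k : Fin (n + 1)) := coordHom W (v n i j k) (hv_le i j k) f
  let cc (n : ℕ) (i j k i' j' k' : Fin (n + 1)) :=
    coordHom W (v n i j k * v n i' j' k') (hvv_le i j k i' j' k') f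
  let o (n : ℕ) := coordHom W (1 : simplexScheme hU hUV n ⟶ G) (h1_le n) f
  have hc {m n : ℕ} (α : Fin (m + 1) → Fin (n + 1)) (i j k : Fin (m + 1)) :
      SimplexRing.reindex (structureHom hUV) α (c m i j k) = c n (α i) (α j) (α k) :=
    coordHom_simplexSchemeMap hV α _ _ _ (hv α i j k) f
  have hcc {m n : ℕ} (α : Fin (m + 1) → Fin (n + 1)) (i j k i' j' k' : Fin (m + 1)) :
      SimplexRing.reindex (structureHom hUV) α (cc m i j k i' j' k') =
        cc n (α i) (α j) (α k) (α i') (α j') (α k') :=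
    coordHom_simplexSchemeMap hV α _ _ _ (by rw [MonObj.comp_mul, hv, hv]) f
  have ho {m n : ℕ} (α : Fin (m + 1) → Fin (n + 1)) :
      SimplexRing.reindex (structureHom hUV) α (o m) = o n :=
    coordHom_simplexSchemeMap hV α _ _ _ (MonObj.comp_one _) f
  have coord_congr {n : ℕ} {g g' : simplexScheme hU hUV n ⟶ G} (h : ⊤ ≤ g.left ⁻¹ᵁ W)
      (h' : ⊤ ≤ g'.left ⁻¹ᵁ W) (e : g = g') : coordHom W g h f = coordHom W g' h' f := by
    subst e; rfl
  have hc_deg {n : ℕ} (i j : Fin (n + 1)) : c n i j j = o n := coord_congr _ _ (hdeg i j)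
  have hcc_left {n : ℕ} (i j i' j' k' : Fin (n + 1)) : cc n i j j i' j' k' = c n i' j' k' :=
    coord_congr _ _ (by rw [hdeg, one_mul])
  have hcc_right {n : ℕ} (i j k i' j' : Fin (n + 1)) : cc n i j k i' j' j' = c n i j k :=
    coord_congr _ _ (by rw [hdeg, mul_one])
  -- F measures the failure of f - f(1) to be additive on η(x_0, x_1, x_2) η(x_0, x_3, x_1). One
  -- factor is trivial when x_1 = x_2, the other when x_1 = x_3, so F vanishes on both diagonals.
  -- The fourth vertex separates these conditions; setting x_3 = x_2 gives the product wanted.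
  have hadd := SimplexRing.reindex_eq_zero (φ := structureHom hUV)
    (F := cc 3 0 1 2 0 3 1 - c 3 0 1 2 - c 3 0 3 1 + o 3)
    (by
      simp only [map_add, map_sub, hc, hcc, ho]
      change cc 3 0 1 1 0 3 1 - c 3 0 1 1 - c 3 0 3 1 + o 3 = 0
      rw [hcc_left, hc_deg]
      ring)
    (by
      simp only [map_add, map_sub, hc, hcc, ho]
      change cc 3 0 1 2 0 1 1 - c 3 0 1 2 - c 3 0 1 1 + o 3 = 0
      rw [hcc_right, hc_deg]
      ring)
  have hswap := SimplexRing.add_swap_eq_zero (φ := structureHom hUV) (F := c 2 0 1 2 - o 2)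
    (by
      simp only [map_sub, hc, ho]
      change c 2 0 1 1 - o 2 = 0
      rw [hc_deg, sub_self])
  simp only [map_add, map_sub, hc, hcc, ho] at hadd hswap
  replace hadd : cc 2 0 1 2 0 2 1 - c 2 0 1 2 - c 2 0 2 1 + o 2 = 0 := hadd
  replace hswap : c 2 0 1 2 - o 2 + (c 2 0 2 1 - o 2) = 0 := hswap
  change cc 2 0 1 2 0 2 1 = o 2
  linear_combination hadd + hswap

/-- Forms of degree two with values in a group scheme are alternating. -/
theorem Cochain.IsForm.isAlternating {ω : Cochain X 2 (yonedaGrpObj G)} (hω : ω.IsForm) : ω.IsAlternating := by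
  intro T x
  refine Over.OverMorphism.ext (Scheme.hom_ext_of_forall _ _ fun t => ?_)
  let p : X.left := (x.vertex 0).left t
  let e : S ⟶ G.left := (1 : Over.mk (𝟙 S) ⟶ G).left
  -- The affine opens are chosen backwards: W around the unit at the image point, V in S mapped into
  -- W by the unit section, U in X lying over V.
  obtain ⟨W, hW, hpW, -⟩ := exists_isAffineOpen_mem_and_subset (x := e (X.hom p)) (U := ⊤) trivial
  obtain ⟨V, hV, hpV, hVW⟩ := exists_isAffineOpen_mem_and_subset (x := X.hom p) (U := e ⁻¹ᵁ W) hpW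
  obtain ⟨U, hU, hpU, hUV⟩ := exists_isAffineOpen_mem_and_subset (x := p) (U := X.hom ⁻¹ᵁ V) hpV
  let T' : T.left.Opens := (x.vertex 0).left ⁻¹ᵁ U
  refine ⟨T', hpU, ?_⟩
  obtain ⟨g, hg⟩ := exists_precomp_eq hU hUV hV x T' fun i => x.isInf.le_preimage 0 i le_rfl
  let r : Over.mk (T'.ι ≫ T.hom) ⟶ T := Over.homMk T'.ι
  suffices h : r ≫ (ω.evalHom x * ω.evalHom (x.proj ![0, 2, 1])) = r ≫ 1 from
    congrArg (fun f => f.left) h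
  have e₁ : r ≫ ω.evalHom x =
      g ≫ ω.evalHom ((universalSimplex hU hUV hV 2).proj ![0, 1, 2]) := by
    rw [ω.comp_evalHom, ω.comp_evalHom, ← Simplex.precomp_proj, ← hg]
    refine congrArg (fun y => ω.evalHom y) (Simplex.ext_vertex fun l => ?_)
    fin_cases l <;> rfl
  have e₂ : r ≫ ω.evalHom (x.proj ![0, 2, 1]) =
      g ≫ ω.evalHom ((universalSimplex hU hUV hV 2).proj ![0, 2, 1]) := by
    rw [ω.comp_evalHom, ω.comp_evalHom, ← Simplex.precomp_proj, ← Simplex.precomp_proj, ← hg]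
  rw [MonObj.comp_mul, e₁, e₂, ← MonObj.comp_mul, evalHom_universalSimplex hU hUV hV hW hVW hω,
    MonObj.comp_one, MonObj.comp_one]

end Values

end CombForm


theorem proposition3p11 {S : Scheme.{u}} (X G : Over S) [GrpObj G]
    (χ : CombForm.Cochain X 1 (CombForm.autPresheaf (yonedaGrpObj G)))
    (η : CombForm.Cochain X 2 (yonedaGrpObj G))
    (hχ : χ.IsForm) (hη : η.IsForm)
    (h : CombForm.delta1 χ = CombForm.innerPush η) :
    (CombForm.delta2 χ η).IsForm ∧
      CombForm.delta3 χ (CombForm.delta2 χ η) = 1 :=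
  ⟨CombForm.isForm_delta2 hχ hη hη.isAlternating,
    CombForm.delta3_delta2 hχ hη hη.isAlternating h⟩
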